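/- All graphs are finite, simple and undirected. For a graph $G$ let $q(G)$ be its signless Laplacian spectral radius, i.e. the largest eigenvalue of $D(G)+A(G)$, where $A(G)$ is the adjacency matrix and $D(G)$ the diagonal matrix of vertex degrees. Write $G_1\cup G_2$ for the disjoint union and $G_1\vee G_2$ for the join of two vertex-disjoint graphs (the disjoint union together with all edges between them), $K_m$ for the complete graph on $m$ vertices, and $mK_1$ for the graph consisting of $m$ isolated vertices. Theorem. Let $k\ge 0$ be an integer and let $G$ be a graph of order $n\ge 5k+7$, where $n\equiv k \pmod 2$. If $$q(G)\ge q\bigl(K_2\vee((k+1)K_1\cup K_{n-k-3})\bigr),$$ then every edge of $G$ is contained in a matching of $G$ of size $\frac{n-k}{2}$, unless $G\cong K_2\vee((k+1)K_1\cup K_{n-k-3})$. -/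

import Mathlib

/-- The join `G ∨ H` of two vertex-disjoint graphs: the disjoint union together with all edges
between a vertex of `G` and a vertex of `H`. -/
def graphJoin {V W : Type*} (G : SimpleGraph V) (H : SimpleGraph W) : SimpleGraph (V ⊕ W) :=
  (G ⊕g H) ⊔ completeBipartiteGraph V W

/-- `K_2 ∨ ((k+1) K_1 ∪ K_{n-k-3})`; here `(k+1) K_1` is the graph on `k + 1` vertices without
edges. (Used only for `k + 3 ≤ n`, so that the subtraction is the genuine one.) -/
def extremalGraph (n k : ℕ) : SimpleGraph (Fin 2 ⊕ (Fin (k + 1) ⊕ Fin (n - k - 3))) :=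
  graphJoin (⊤ : SimpleGraph (Fin 2))
    ((⊥ : SimpleGraph (Fin (k + 1))) ⊕g (⊤ : SimpleGraph (Fin (n - k - 3))))

open Classical in
/-- The signless Laplacian matrix `Q(G) = D(G) + A(G)`. -/
noncomputable def signlessLaplacian {V : Type*} [Fintype V] (G : SimpleGraph V) : Matrix V V ℝ :=
  G.degMatrix ℝ + G.adjMatrix ℝ

open Classical in
/-- The signless Laplacian spectral radius `q(G)`: the largest (real) eigenvalue of `Q(G)`. -/
noncomputable def signlessSpectralRadius {V : Type*} [Fintype V] (G : SimpleGraph V) : ℝ :=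
  sSup {μ : ℝ | Module.End.HasEigenvalue (Matrix.toLin' (signlessLaplacian G)) μ}

open Classical in
/-- On a nonempty vertex set the supremum defining `q(G)` is a maximum: `q(G)` is an eigenvalue
of `Q(G)`, and the largest one. -/
theorem isGreatest_signlessSpectralRadius {V : Type*} [Fintype V] [Nonempty V]
    (G : SimpleGraph V) :
    IsGreatest {μ : ℝ | Module.End.HasEigenvalue (Matrix.toLin' (signlessLaplacian G)) μ}
      (signlessSpectralRadius G) := by
  have hQ : (signlessLaplacian G).IsHermitian :=
    (G.isHermitian_degMatrix ℝ).add (G.isHermitian_adjMatrix ℝ)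
  have hS : {μ : ℝ | Module.End.HasEigenvalue (Matrix.toLin' (signlessLaplacian G)) μ}
      = Set.range hQ.eigenvalues := by
    rw [← hQ.spectrum_real_eq_range_eigenvalues, ← Matrix.spectrum_toLin']
    ext μ
    exact Module.End.hasEigenvalue_iff_mem_spectrum
  unfold signlessSpectralRadius
  rw [hS]
  exact ⟨(Set.range_nonempty _).csSup_mem (Set.finite_range _),
    fun _ hx => le_csSup (Set.finite_range _).bddAbove hx⟩

/-- `G` has a matching of size `m` containing any given edge: every edge of `G` lies in some
matching of `G` with exactly `m` edges. -/
def EveryEdgeInMatchingOfSize {V : Type*} (G : SimpleGraph V) (m : ℕ) : Prop :=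
  ∀ e ∈ G.edgeSet, ∃ M : G.Subgraph, M.IsMatching ∧ M.edgeSet.ncard = m ∧ e ∈ M.edgeSet

/-!
Suppose that an edge `uv` of `G` lies in no matching of size `(n - k) / 2`. Tutte's theorem, applied
to the join of `G - u - v` with `K_k`, gives a set `S ∋ u, v` of some size `s ≥ 2` such that `G - S`
has at least `s + k` components (`exists_cut_of_forall_not_isMatching`). In the extremal graph the
two vertices of the `K_2` form such a cut, with `k + 2` components.

The extremal graph contains the complete graph on `n - k - 1` vertices and more edges, so its `q`
exceeds `q₀ = 2 (n - k - 2)` (`lt_signlessSpectralRadius_extremalGraph`). On the other side, a cut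
of size `s` with many components bounds `q(G)` from above: the positive vector that is `1` on `S`
and `s / (q₀ - s + 2 - 2 N)` on a component of size `N` satisfies `Q(G) w ≤ q₀ w`, whence
`q(G) ≤ q₀` by the Collatz–Wielandt principle (`signlessSpectralRadius_le_of_classes`). Outside `S`
the inequality is built into the choice of `w`. On `S` it is a numerical condition on the component
sizes, and by convexity the worst case is one large component next to singletons. The condition
holds for every `s ≥ 3` (`large_cut_inequality`); the case of equality `n = 2 s + k`, `s = 2 k + 4`
shows where the bound on `n` comes from. It also holds for `s = 2` as long as every component has
at most `n - k - 4` vertices (`cut_two_inequality`).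

The remaining case is `s = 2` with a component of `n - k - 3` vertices. Then the other components are
singletons, so `G` is a spanning subgraph of the extremal graph (`lt_or_iso_extremalGraph`), and a
proper one has strictly smaller `q` by Perron–Frobenius (`signlessSpectralRadius_lt_of_lt`).
-/

/-! ### The signless Laplacian and its largest eigenvalue -/

open Classical in
theorem signlessLaplacian_mulVec_apply {V : Type*} [Fintype V] (G : SimpleGraph V) (x : V → ℝ)
    (i : V) :
    Matrix.mulVec (signlessLaplacian G) x i = ∑ j, if G.Adj i j then x i + x j else 0 := by
  have h1 : Matrix.mulVec (G.degMatrix ℝ) x i = G.degree i * x i := by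
    simp [SimpleGraph.degMatrix, Matrix.mulVec_diagonal]
  rw [signlessLaplacian, Matrix.add_mulVec, Pi.add_apply, h1, SimpleGraph.adjMatrix_mulVec_apply,
    ← Finset.sum_filter, Finset.sum_add_distrib, Finset.sum_const, nsmul_eq_mul,
    ← SimpleGraph.neighborFinset_eq_filter, SimpleGraph.card_neighborFinset_eq_degree]

theorem isHermitian_signlessLaplacian {V : Type*} [Fintype V] (G : SimpleGraph V) :
    (signlessLaplacian G).IsHermitian := by
  classical
  exact (G.isHermitian_degMatrix ℝ).add (G.isHermitian_adjMatrix ℝ)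

theorem exists_eigenvector_signlessSpectralRadius {V : Type*} [Fintype V] [Nonempty V]
    (G : SimpleGraph V) :
    ∃ x : V → ℝ, x ≠ 0 ∧
      Matrix.mulVec (signlessLaplacian G) x = signlessSpectralRadius G • x := by
  classical
  obtain ⟨x, hx⟩ := (isGreatest_signlessSpectralRadius G).1.exists_hasEigenvector
  exact ⟨x, hx.2, by simpa using hx.apply_eq_smul⟩

theorem le_signlessSpectralRadius {V : Type*} [Fintype V] [Nonempty V]
    (G : SimpleGraph V) {μ : ℝ} {x : V → ℝ} (hx : x ≠ 0)
    (h : Matrix.mulVec (signlessLaplacian G) x = μ • x) : μ ≤ signlessSpectralRadius G := by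
  classical
  refine (isGreatest_signlessSpectralRadius G).2 ?_
  exact Module.End.hasEigenvalue_of_hasEigenvector (x := x)
    ⟨Module.End.mem_eigenspace_iff.2 (by simpa using h), hx⟩

open Classical in
/-- Collatz–Wielandt bound: a positive vector `w` with `Q(G) w ≤ c w` entrywise certifies
`q(G) ≤ c`. -/
theorem signlessSpectralRadius_le_of_pos_vector {V : Type*} [Fintype V] [Nonempty V]
    (G : SimpleGraph V) {c : ℝ} (w : V → ℝ) (hw : ∀ i, 0 < w i)
    (h : ∀ i, (∑ j, if G.Adj i j then w i + w j else 0) ≤ c * w i) :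
    signlessSpectralRadius G ≤ c := by
  obtain ⟨x, hx0, hx⟩ := exists_eigenvector_signlessSpectralRadius G
  set q := signlessSpectralRadius G
  -- The row where `|x i| / w i` is largest is the one to compare.
  obtain ⟨i, -, hi⟩ := Finset.exists_max_image Finset.univ (fun i => |x i| / w i)
    Finset.univ_nonempty
  set r := |x i| / w i with hr
  have hle : ∀ j, |x j| ≤ r * w j := fun j => by
    have := hi j (Finset.mem_univ j)
    rwa [div_le_iff₀ (hw j)] at this
  have hxi : |x i| = r * w i := by rw [hr, div_mul_cancel₀ _ (hw i).ne']
  have hipos : 0 < |x i| := by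
    by_contra hcon
    have h0 : |x i| = 0 := le_antisymm (not_lt.1 hcon) (abs_nonneg _)
    refine hx0 (funext fun j => ?_)
    have := hle j
    rw [hr, h0, zero_div, zero_mul] at this
    exact abs_eq_zero.1 (le_antisymm this (abs_nonneg _))
  have hrow : q * x i = ∑ j, if G.Adj i j then x i + x j else 0 := by
    rw [← signlessLaplacian_mulVec_apply, hx]; simp
  have hr0 : 0 ≤ r := div_nonneg (abs_nonneg _) (hw i).le
  have key : q * |x i| ≤ c * |x i| := by
    calc q * |x i| ≤ |q| * |x i| := by gcongr; exact le_abs_self q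
      _ = |∑ j, if G.Adj i j then x i + x j else 0| := by rw [← abs_mul, hrow]
      _ ≤ ∑ j, |if G.Adj i j then x i + x j else 0| := Finset.abs_sum_le_sum_abs _ _
      _ ≤ ∑ j, r * (if G.Adj i j then w i + w j else 0) := by
          refine Finset.sum_le_sum fun j _ => ?_
          split_ifs
          · calc |x i + x j| ≤ |x i| + |x j| := abs_add_le _ _
              _ ≤ r * w i + r * w j := add_le_add (hle i) (hle j)
              _ = r * (w i + w j) := by ring
          · simp
      _ = r * ∑ j, (if G.Adj i j then w i + w j else 0) := by rw [Finset.mul_sum]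
      _ ≤ r * (c * w i) := by gcongr; exact h i
      _ = c * |x i| := by rw [hxi]; ring
  exact le_of_mul_le_mul_right key hipos

open Classical in
/-- Twice the quadratic form of `Q(G)`, as a sum of squares over ordered adjacent pairs. -/
theorem two_mul_dotProduct_signlessLaplacian {V : Type*} [Fintype V] (G : SimpleGraph V)
    (x : V → ℝ) :
    2 * dotProduct x (Matrix.mulVec (signlessLaplacian G) x) =
      ∑ i, ∑ j, if G.Adj i j then (x i + x j) ^ 2 else 0 := by
  have h1 : dotProduct x (Matrix.mulVec (signlessLaplacian G) x) =
      ∑ i, ∑ j, if G.Adj i j then x i * (x i + x j) else 0 := by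
    simp only [dotProduct, signlessLaplacian_mulVec_apply, Finset.mul_sum, mul_ite, mul_zero]
  have h2 : dotProduct x (Matrix.mulVec (signlessLaplacian G) x) =
      ∑ i, ∑ j, if G.Adj i j then x j * (x i + x j) else 0 := by
    rw [h1, Finset.sum_comm]
    refine Finset.sum_congr rfl fun i _ => Finset.sum_congr rfl fun j _ => ?_
    simp only [G.adj_comm j i, add_comm (x j) (x i)]
  rw [two_mul]
  nth_rw 1 [h1]
  rw [h2, ← Finset.sum_add_distrib]
  refine Finset.sum_congr rfl fun i _ => ?_
  rw [← Finset.sum_add_distrib]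
  refine Finset.sum_congr rfl fun j _ => ?_
  split_ifs
  · ring
  · simp

open Classical in
theorem posSemidef_signlessSpectralRadius_sub {V : Type*} [Fintype V] [Nonempty V]
    (G : SimpleGraph V) :
    (signlessSpectralRadius G • (1 : Matrix V V ℝ) - signlessLaplacian G).PosSemidef := by
  set A := signlessSpectralRadius G • (1 : Matrix V V ℝ) - signlessLaplacian G with hA
  have hH : A.IsHermitian := by
    refine Matrix.IsHermitian.sub ?_ (isHermitian_signlessLaplacian G)
    ext i j
    simp [Matrix.one_apply, eq_comm]
  rw [hH.posSemidef_iff_eigenvalues_nonneg]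
  intro i
  have hv := hH.mulVec_eigenvectorBasis i
  have hne : (⇑(hH.eigenvectorBasis i) : V → ℝ) ≠ 0 := by
    intro h0
    exact hH.eigenvectorBasis.orthonormal.ne_zero i (by ext j; simpa using congrFun h0 j)
  have hv2 : Matrix.mulVec (signlessLaplacian G) (⇑(hH.eigenvectorBasis i)) =
      (signlessSpectralRadius G - hH.eigenvalues i) • (⇑(hH.eigenvectorBasis i) : V → ℝ) := by
    have hAv : ∀ v, A.mulVec v = signlessSpectralRadius G • v - (signlessLaplacian G).mulVec v := by
      intro v
      rw [hA, Matrix.sub_mulVec, Matrix.smul_mulVec, Matrix.one_mulVec]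
    rw [sub_smul, ← hv, hAv]
    abel
  have := le_signlessSpectralRadius G hne hv2
  simp only [Pi.zero_apply]
  linarith

theorem dotProduct_signlessSpectralRadius_sub_mulVec {V : Type*} [Fintype V] [DecidableEq V]
    (G : SimpleGraph V) (x : V → ℝ) :
    dotProduct x (Matrix.mulVec
      (signlessSpectralRadius G • (1 : Matrix V V ℝ) - signlessLaplacian G) x) =
      signlessSpectralRadius G * dotProduct x x -
        dotProduct x (Matrix.mulVec (signlessLaplacian G) x) := by
  rw [Matrix.sub_mulVec, Matrix.smul_mulVec, Matrix.one_mulVec, dotProduct_sub, dotProduct_smul,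
    smul_eq_mul]

/-- Rayleigh's principle for `Q(G)`. -/
theorem dotProduct_signlessLaplacian_le {V : Type*} [Fintype V] [Nonempty V] (G : SimpleGraph V)
    (x : V → ℝ) :
    dotProduct x (Matrix.mulVec (signlessLaplacian G) x) ≤
      signlessSpectralRadius G * dotProduct x x := by
  classical
  have h := (posSemidef_signlessSpectralRadius_sub G).dotProduct_mulVec_nonneg x
  rw [star_trivial, dotProduct_signlessSpectralRadius_sub_mulVec] at h
  linarith

/-- Equality in Rayleigh's principle is attained only by eigenvectors. -/
theorem signlessLaplacian_mulVec_eq_of_le {V : Type*} [Fintype V] [Nonempty V]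
    (G : SimpleGraph V) {x : V → ℝ} (h : signlessSpectralRadius G * dotProduct x x ≤
      dotProduct x (Matrix.mulVec (signlessLaplacian G) x)) :
    Matrix.mulVec (signlessLaplacian G) x = signlessSpectralRadius G • x := by
  classical
  have h0 := ((posSemidef_signlessSpectralRadius_sub G).dotProduct_mulVec_zero_iff x).1 (by
    rw [star_trivial, dotProduct_signlessSpectralRadius_sub_mulVec]
    exact le_antisymm (by linarith) (by linarith [dotProduct_signlessLaplacian_le G x]))
  rw [Matrix.sub_mulVec, Matrix.smul_mulVec, Matrix.one_mulVec] at h0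
  exact (sub_eq_zero.1 h0).symm

/-- Strict monotonicity: deleting edges from a graph with a vertex adjacent to all others strictly
decreases `q`. (Connectedness would do; a dominating vertex makes the positivity of the eigenvector
immediate.) -/
theorem signlessSpectralRadius_lt_of_lt {V : Type*} [Fintype V] {G H : SimpleGraph V}
    (hlt : G < H) {c : V} (hc : ∀ v, v ≠ c → H.Adj c v) :
    signlessSpectralRadius G < signlessSpectralRadius H := by
  classical
  have : Nonempty V := ⟨c⟩
  by_contra! hq
  obtain ⟨x, hx0, hx⟩ := exists_eigenvector_signlessSpectralRadius G
  set y : V → ℝ := fun i => |x i| with hy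
  have hy0 : ∀ i, 0 ≤ y i := fun i => abs_nonneg _
  have hyy : dotProduct y y = dotProduct x x := by simp [dotProduct, hy]
  have hGy : signlessSpectralRadius G * dotProduct y y ≤
      dotProduct y (Matrix.mulVec (signlessLaplacian G) y) := by
    have h1 : signlessSpectralRadius G * dotProduct x x =
        dotProduct x (Matrix.mulVec (signlessLaplacian G) x) := by
      rw [hx, dotProduct_smul, smul_eq_mul]
    have h2 := two_mul_dotProduct_signlessLaplacian G x
    have h3 := two_mul_dotProduct_signlessLaplacian G y
    have h4 : (∑ i, ∑ j, if G.Adj i j then (x i + x j) ^ 2 else 0) ≤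
        ∑ i, ∑ j, if G.Adj i j then (y i + y j) ^ 2 else 0 := by
      refine Finset.sum_le_sum fun i _ => Finset.sum_le_sum fun j _ => ?_
      split_ifs
      · refine sq_le_sq.2 ((abs_add_le _ _).trans (le_abs_self _))
      · rfl
    rw [hyy, h1]
    linarith
  have hle : ∀ i j, (if G.Adj i j then (y i + y j) ^ 2 else 0) ≤
      if H.Adj i j then (y i + y j) ^ 2 else 0 := by
    intro i j
    by_cases hG : G.Adj i j
    · simp [hG, hlt.le hG]
    · simp only [hG, if_false]
      split_ifs <;> positivity
  have hGH : dotProduct y (Matrix.mulVec (signlessLaplacian G) y) ≤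
      dotProduct y (Matrix.mulVec (signlessLaplacian H) y) := by
    have h2 := two_mul_dotProduct_signlessLaplacian G y
    have h3 := two_mul_dotProduct_signlessLaplacian H y
    have := Finset.sum_le_sum fun i (_ : i ∈ Finset.univ) =>
      Finset.sum_le_sum fun j (_ : j ∈ Finset.univ) => hle i j
    linarith
  have hyy0 : 0 ≤ dotProduct y y := Finset.sum_nonneg fun i _ => mul_self_nonneg _
  have hmul := mul_le_mul_of_nonneg_right hq hyy0
  have hHy := signlessLaplacian_mulVec_eq_of_le H (x := y) (by linarith)
  -- `y` is an eigenvector of `Q(H)`; a zero entry of it forces zero entries at all neighbours.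
  have hzero : ∀ i, y i = 0 → ∀ j, H.Adj i j → y j = 0 := by
    intro i hi j hij
    have h1 := congrFun hHy i
    rw [signlessLaplacian_mulVec_apply, Pi.smul_apply, hi, smul_zero] at h1
    have h2 := (Finset.sum_eq_zero_iff_of_nonneg (fun k _ => by
      split_ifs
      · exact add_nonneg le_rfl (hy0 k)
      · exact le_rfl)).1 h1 j (Finset.mem_univ j)
    simpa [hij] using h2
  have hyc : y c ≠ 0 := by
    intro h
    refine hx0 (funext fun v => abs_eq_zero.1 ?_)
    by_cases hv : v = c
    · rw [hv]; exact h
    · exact hzero c h v (hc v hv)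
  have hpos : ∀ v, 0 < y v := by
    intro v
    refine lt_of_le_of_ne (hy0 v) fun h => hyc ?_
    by_cases hv : v = c
    · rw [← hv]; exact h.symm
    · exact hzero v h.symm c (hc v hv).symm
  obtain ⟨a, b, hHab, hGab⟩ : ∃ a b, H.Adj a b ∧ ¬ G.Adj a b := by
    by_contra! hcon
    exact hlt.not_ge fun a b h => hcon a b h
  have hstrict : (∑ i, ∑ j, if G.Adj i j then (y i + y j) ^ 2 else 0) <
      ∑ i, ∑ j, if H.Adj i j then (y i + y j) ^ 2 else 0 := by
    refine Finset.sum_lt_sum (fun i _ => Finset.sum_le_sum fun j _ => hle i j)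
      ⟨a, Finset.mem_univ a, Finset.sum_lt_sum (fun j _ => hle a j) ⟨b, Finset.mem_univ b, ?_⟩⟩
    have := hpos a
    have := hpos b
    simp only [hHab, hGab, if_true, if_false]
    positivity
  have h2 := two_mul_dotProduct_signlessLaplacian G y
  have h3 := two_mul_dotProduct_signlessLaplacian H y
  have h5 := dotProduct_signlessLaplacian_le H y
  linarith

theorem SimpleGraph.Iso.signlessSpectralRadius_le {V W : Type*} [Fintype V] [Fintype W]
    [Nonempty V] {G : SimpleGraph V} {H : SimpleGraph W} (e : G ≃g H) :
    signlessSpectralRadius G ≤ signlessSpectralRadius H := by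
  classical
  have : Nonempty W := (Nonempty.map e inferInstance)
  obtain ⟨x, hx0, hx⟩ := exists_eigenvector_signlessSpectralRadius G
  refine le_signlessSpectralRadius H (x := fun w => x (e.symm w)) (fun h => hx0 ?_) ?_
  · funext v
    simpa using congrFun h (e v)
  · funext w
    have h1 := congrFun hx (e.symm w)
    rw [signlessLaplacian_mulVec_apply] at h1 ⊢
    rw [Pi.smul_apply] at h1 ⊢
    rw [← h1, ← e.toEquiv.sum_comp]
    refine Finset.sum_congr rfl fun j _ => ?_
    have hadj : H.Adj w (e j) ↔ G.Adj (e.symm w) j := by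
      rw [← e.map_adj_iff, e.apply_symm_apply]
    simp [hadj]

theorem SimpleGraph.Iso.signlessSpectralRadius_eq {V W : Type*} [Fintype V] [Fintype W]
    [Nonempty V] {G : SimpleGraph V} {H : SimpleGraph W} (e : G ≃g H) :
    signlessSpectralRadius G = signlessSpectralRadius H :=
  have : Nonempty W := (Nonempty.map e inferInstance)
  le_antisymm e.signlessSpectralRadius_le e.symm.signlessSpectralRadius_le

/-! ### An upper bound for `q` from a vertex cut with many components -/

theorem Finset.sum_inv_card_fiber {V ι : Type*} [DecidableEq ι] (T : Finset V) (f : V → ι) :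
    ∑ a ∈ T, ((T.filter (fun b => f b = f a)).card : ℝ)⁻¹ = (T.image f).card := by
  rw [← Finset.sum_fiberwise_of_maps_to (fun a ha => Finset.mem_image_of_mem f ha),
    Finset.card_eq_sum_ones, Nat.cast_sum]
  refine Finset.sum_congr rfl fun l hl => ?_
  obtain ⟨a, ha, rfl⟩ := Finset.mem_image.1 hl
  have h : ∀ b ∈ T.filter (fun b => f b = f a),
      ((T.filter (fun c => f c = f b)).card : ℝ)⁻¹ =
        ((T.filter (fun c => f c = f a)).card : ℝ)⁻¹ := by
    intro b hb
    rw [(Finset.mem_filter.1 hb).2]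
  rw [Finset.sum_congr rfl h, Finset.sum_const, nsmul_eq_mul, Nat.cast_one]
  refine mul_inv_cancel₀ (Nat.cast_ne_zero.2 (Finset.card_ne_zero.2 ⟨a, ?_⟩))
  simp [ha]

/-- The convex function `t ↦ t / (c - 2 t)` lies below its chord over `[1, B]`; here divided by
`t = N`. -/
theorem inv_sub_two_mul_le {c N B : ℝ} (hN : 1 ≤ N) (hNB : N ≤ B) (hc : 2 * B < c) :
    (c - 2 * N)⁻¹ ≤ c / ((c - 2) * (c - 2 * B)) -
      (c / ((c - 2) * (c - 2 * B)) - 1 / (c - 2)) * N⁻¹ := by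
  have h1 : 0 < c - 2 := by linarith
  have h2 : 0 < c - 2 * B := by linarith
  have h3 : 0 < c - 2 * N := by linarith
  have h4 : (0 : ℝ) < N := by linarith
  have key : c / ((c - 2) * (c - 2 * B)) -
      (c / ((c - 2) * (c - 2 * B)) - 1 / (c - 2)) * N⁻¹ - (c - 2 * N)⁻¹ =
      2 * c * (N - 1) * (B - N) / (N * (c - 2) * (c - 2 * B) * (c - 2 * N)) := by
    field_simp
    ring
  have h5 : 0 ≤ 2 * c * (N - 1) * (B - N) / (N * (c - 2) * (c - 2 * B) * (c - 2 * N)) := by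
    have : 0 ≤ N - 1 := by linarith
    have : 0 ≤ B - N := by linarith
    have : 0 < c := by linarith
    positivity
  linarith

/-- Suppose that the vertices outside `S` fall into at least `p` classes, each of size at most `B`,
and that no edge joins two of these classes (`f` names the class of a vertex; its values on `S` are
irrelevant). The numerical condition says that the row sums on `S` of the vector equal to `1` on `S`
and to `s / (c - 2 N)` on a class of size `N` are at most `q₀`; the rows outside `S` are at most
`q₀` times the entry by the choice of the vector. Convexity makes one class of size `B` next to
singletons the worst case. -/
theorem signlessSpectralRadius_le_of_classes {V ι : Type*} [Fintype V] [DecidableEq V]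
    [DecidableEq ι] (G : SimpleGraph V) {S : Finset V} (hS : S.Nonempty) {f : V → ι}
    (hf : ∀ a ∉ S, ∀ b ∉ S, G.Adj a b → f a = f b) {p B : ℕ} (hp : p ≤ (Sᶜ.image f).card)
    (hB1 : 1 ≤ B) (hB : ∀ a ∉ S, (Sᶜ.filter (fun b => f b = f a)).card ≤ B)
    {q₀ c : ℝ} (hcq : c = q₀ - S.card + 2) (hc : 2 * (B : ℝ) < c)
    (hnum : (Fintype.card V : ℝ) + S.card - 2 + S.card * (p / (c - 2) +
      c / ((c - 2) * (c - 2 * B)) * (Fintype.card V - S.card - p)) ≤ q₀) :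
    signlessSpectralRadius G ≤ q₀ := by
  classical
  have : Nonempty V := ⟨hS.choose⟩
  set s : ℝ := (S.card : ℝ) with hs
  have hs0 : 0 < s := by rw [hs]; exact_mod_cast hS.card_pos
  set N : V → ℝ := fun a => ((Sᶜ.filter (fun b => f b = f a)).card : ℝ) with hN
  have hN1 : ∀ a ∉ S, 1 ≤ N a := by
    intro a ha
    have : 0 < (Sᶜ.filter (fun b => f b = f a)).card := Finset.card_pos.2 ⟨a, by simp [ha]⟩
    exact Nat.one_le_cast.2 this
  have hNB : ∀ a ∉ S, N a ≤ B := by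
    intro a ha
    exact Nat.cast_le.2 (hB a ha)
  have hcN : ∀ a ∉ S, 0 < c - 2 * N a := fun a ha => by linarith [hNB a ha]
  have hB1' : (1 : ℝ) ≤ B := by exact_mod_cast hB1
  set w : V → ℝ := fun a => if a ∈ S then 1 else s * (c - 2 * N a)⁻¹ with hw
  have hwS : ∀ a ∈ S, w a = 1 := fun a ha => by simp [hw, ha]
  have hwn : ∀ a ∉ S, w a = s * (c - 2 * N a)⁻¹ := fun a ha => by simp [hw, ha]
  have hwpos : ∀ a, 0 < w a := by
    intro a
    by_cases ha : a ∈ S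
    · rw [hwS a ha]; exact one_pos
    · rw [hwn a ha]; exact mul_pos hs0 (inv_pos.2 (hcN a ha))
  refine signlessSpectralRadius_le_of_pos_vector G w hwpos fun i => ?_
  by_cases hi : i ∈ S
  · set σ := c / ((c - 2) * (c - 2 * B)) with hσ
    have hσ1 : 1 / (c - 2) ≤ σ := by
      rw [hσ, div_le_div_iff₀ (by linarith) (mul_pos (by linarith) (by linarith))]
      nlinarith
    have hout : ∑ j ∈ Sᶜ, w j ≤
        s * (p / (c - 2) + σ * (Fintype.card V - s - p)) := by
      calc ∑ j ∈ Sᶜ, w j ≤ ∑ j ∈ Sᶜ, s * (σ - (σ - 1 / (c - 2)) * (N j)⁻¹) := by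
            refine Finset.sum_le_sum fun j hj => ?_
            have hj' := Finset.mem_compl.1 hj
            rw [hwn j hj']
            exact mul_le_mul_of_nonneg_left
              (inv_sub_two_mul_le (hN1 j hj') (hNB j hj') hc) hs0.le
        _ = s * (σ * (Fintype.card V - s) - (σ - 1 / (c - 2)) * (Sᶜ.image f).card) := by
            rw [← Finset.mul_sum, Finset.sum_sub_distrib, ← Finset.mul_sum,
              Finset.sum_inv_card_fiber, Finset.sum_const, nsmul_eq_mul, Finset.card_compl,
              Nat.cast_sub (Finset.card_le_univ S)]
            ring
        _ ≤ s * (σ * (Fintype.card V - s) - (σ - 1 / (c - 2)) * p) := by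
            have hp' : (p : ℝ) ≤ (Sᶜ.image f).card := by exact_mod_cast hp
            have := mul_le_mul_of_nonneg_left hp' (sub_nonneg.2 hσ1)
            exact mul_le_mul_of_nonneg_left (by linarith) hs0.le
        _ = s * (p / (c - 2) + σ * (Fintype.card V - s - p)) := by ring
    calc (∑ j, if G.Adj i j then w i + w j else 0)
        ≤ ∑ j ∈ Finset.univ.erase i, (1 + w j) := by
          rw [← Finset.sum_filter, hwS i hi]
          refine Finset.sum_le_sum_of_subset_of_nonneg (fun j hj => ?_) fun j _ _ => ?_
          · simp only [Finset.mem_filter, Finset.mem_univ, true_and] at hj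
            simp [hj.ne']
          · have := hwpos j; positivity
      _ = Fintype.card V + s - 2 + ∑ j ∈ Sᶜ, w j := by
          have h1 : ∑ j, (1 + w j) = (Fintype.card V : ℝ) + (s + ∑ j ∈ Sᶜ, w j) := by
            rw [Finset.sum_add_distrib, ← Finset.sum_add_sum_compl S w,
              Finset.sum_congr rfl hwS]
            simp [hs]
          have h2 := Finset.add_sum_erase Finset.univ (fun j => 1 + w j) (Finset.mem_univ i)
          simp only [hwS i hi] at h2
          linarith
      _ ≤ q₀ * w i := by rw [hwS i hi]; linarith
  · set C := Sᶜ.filter (fun b => f b = f i) with hC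
    have hiC : i ∈ C := by simp [hC, hi]
    calc (∑ j, if G.Adj i j then w i + w j else 0)
        ≤ ∑ j ∈ S ∪ C.erase i, (w i + w j) := by
          rw [← Finset.sum_filter]
          refine Finset.sum_le_sum_of_subset_of_nonneg (fun j hj => ?_) fun j _ _ => ?_
          · simp only [Finset.mem_filter, Finset.mem_univ, true_and] at hj
            by_cases hjS : j ∈ S
            · simp [hjS]
            · simp [hjS, hC, hj.ne', hf i hi j hjS hj]
          · have := hwpos j; have := hwpos i; positivity
      _ = ∑ j ∈ S, (w i + 1) + ∑ j ∈ C.erase i, (w i + w i) := by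
          rw [Finset.sum_union]
          · congr 1
            · exact Finset.sum_congr rfl fun j hj => by rw [hwS j hj]
            · refine Finset.sum_congr rfl fun j hj => ?_
              have hj' := Finset.mem_filter.1 (Finset.mem_of_mem_erase hj)
              have hNj : N j = N i := by simp only [hN, hj'.2]
              rw [hwn i hi, hwn j (Finset.mem_compl.1 hj'.1), hNj]
          · refine Finset.disjoint_left.2 fun j hj hj' => ?_
            exact Finset.mem_compl.1 (Finset.mem_filter.1 (Finset.mem_of_mem_erase hj')).1 hj
      _ = s * (w i + 1) + (N i - 1) * (w i + w i) := by
          rw [Finset.sum_const, Finset.sum_const, Finset.card_erase_of_mem hiC, nsmul_eq_mul,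
            nsmul_eq_mul, Nat.cast_sub (Finset.card_pos.2 ⟨i, hiC⟩), Nat.cast_one]
      _ = q₀ * w i := by
          have h1 : w i * (c - 2 * N i) = s := by
            rw [hwn i hi, mul_assoc, inv_mul_cancel₀ (hcN i hi).ne', mul_one]
          rw [hcq] at h1
          linarith

/-- The numerical condition of `signlessSpectralRadius_le_of_classes` for a cut of size `s ≥ 3`,
with `q₀ = 2 (L - 2)`, `L = n - k`. It is an equality at `L = 2 s = 4 k + 8`, which is where the
hypothesis on the order of the graph comes from. -/
theorem large_cut_inequality {L k s : ℝ} (hs : 3 ≤ s) (hL : 2 * s ≤ L)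
    (hk : 4 * k + 8 ≤ L) :
    L + k + s - 2 + s * ((s + k) / (2 * L - 2 - s - 2) +
      (2 * L - 2 - s) / ((2 * L - 2 - s - 2) * (2 * L - 2 - s - 2 * (L - 2 * s + 1))) *
        (L + k - s - (s + k))) ≤ 2 * (L - 2) := by
  obtain ⟨d, rfl⟩ : ∃ d, L = 2 * s + d := ⟨L - 2 * s, by ring⟩
  have hd : 0 ≤ d := by linarith
  obtain ⟨E, hE⟩ : ∃ E, E = 3 * s - 4 := ⟨_, rfl⟩
  obtain ⟨D, hD⟩ : ∃ D, D = 3 * s + 2 * d - 4 := ⟨_, rfl⟩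
  have hE0 : 0 < E := by linarith
  have hD0 : 0 < D := by linarith
  have e1 : 2 * (2 * s + d) - 2 - s - 2 = D := by rw [hD]; ring
  have e2 : 2 * (2 * s + d) - 2 - s - 2 * (2 * s + d - 2 * s + 1) = E := by rw [hE]; ring
  have e3 : s * ((s + k) / D + (2 * (2 * s + d) - 2 - s) / (D * E) *
      (2 * s + d + k - s - (s + k))) = s * ((s + k - 1) / D + (d + 1) / E) := by
    field_simp
    rw [hE, hD]
    ring
  have h1 : (s + k - 1) / D ≤ (6 * s - 12) / (4 * E) := by
    rw [div_le_div_iff₀ hD0 (by linarith), hD]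
    have h := mul_le_mul_of_nonneg_right hk hE0.le
    rw [hE] at h ⊢
    nlinarith [mul_nonneg hd (by linarith : (0 : ℝ) ≤ 9 * s - 20)]
  have h2 : s * ((6 * s - 12) / (4 * E) + (d + 1) / E) ≤ s / 2 + 3 * d / 4 := by
    have e4 : s * ((6 * s - 12) / (4 * E) + (d + 1) / E) = s / 2 + s * d / E := by
      field_simp
      rw [hE]
      ring
    have h3 : s * d / E ≤ 3 * d / 4 := by
      rw [div_le_div_iff₀ hE0 (by norm_num), hE]
      nlinarith
    linarith
  rw [e1, e2, e3]
  have h4 := mul_le_mul_of_nonneg_left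
    (add_le_add_left h1 ((d + 1) / E)) (by linarith : (0 : ℝ) ≤ s)
  linarith

/-- The numerical condition of `signlessSpectralRadius_le_of_classes` for a cut of size `2`
and classes of at most `L - 4` vertices, one less than in the extremal graph. -/
theorem cut_two_inequality {L k : ℝ} (hk0 : 0 ≤ k) (hk : 4 * k + 8 ≤ L) :
    L + k + 2 - 2 + 2 * ((2 + k) / (2 * L - 4 - 2) +
      (2 * L - 4) / ((2 * L - 4 - 2) * (2 * L - 4 - 2 * (L - 4))) *
        (L + k - 2 - (2 + k))) ≤ 2 * (L - 2) := by
  have h1 : 0 < 2 * L - 4 - 2 := by linarith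
  have e2 : 2 * L - 4 - 2 * (L - 4) = 4 := by ring
  have e3 : 2 * ((2 + k) / (2 * L - 4 - 2) +
      (2 * L - 4) / ((2 * L - 4 - 2) * 4) * (L + k - 2 - (2 + k))) =
      (2 * (2 + k) + (L - 2) * (L - 4)) / (2 * L - 4 - 2) := by
    field_simp
    ring
  have h4 : (2 * (2 + k) + (L - 2) * (L - 4)) / (2 * L - 4 - 2) ≤ L - k - 4 := by
    rw [div_le_iff₀ h1]
    nlinarith [mul_nonneg (by linarith : (0 : ℝ) ≤ L - 2) (by linarith : (0 : ℝ) ≤ L - 4),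
      mul_le_mul_of_nonneg_right hk h1.le]
  rw [e2, e3]
  linarith

/-! ### The extremal graph -/

@[simp] theorem extremalGraph_adj_inl_inl {n k : ℕ} (a b : Fin 2) :
    (extremalGraph n k).Adj (Sum.inl a) (Sum.inl b) ↔ a ≠ b := by
  simp [extremalGraph, graphJoin]

@[simp] theorem extremalGraph_adj_inl_inr {n k : ℕ} (a : Fin 2)
    (b : Fin (k + 1) ⊕ Fin (n - k - 3)) :
    (extremalGraph n k).Adj (Sum.inl a) (Sum.inr b) := by
  simp [extremalGraph, graphJoin]

@[simp] theorem extremalGraph_adj_inr_inl {n k : ℕ} (a : Fin 2)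
    (b : Fin (k + 1) ⊕ Fin (n - k - 3)) :
    (extremalGraph n k).Adj (Sum.inr b) (Sum.inl a) :=
  (extremalGraph_adj_inl_inr a b).symm

@[simp] theorem extremalGraph_adj_clique {n k : ℕ} (a b : Fin (n - k - 3)) :
    (extremalGraph n k).Adj (Sum.inr (Sum.inr a)) (Sum.inr (Sum.inr b)) ↔ a ≠ b := by
  simp [extremalGraph, graphJoin]

/-- The extremal graph contains a clique on `n - k - 1` vertices and further edges, so Rayleigh's
principle for the indicator vector of the clique gives a strict inequality. -/
theorem lt_signlessSpectralRadius_extremalGraph {n k : ℕ} (h : k + 3 ≤ n) :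
    2 * ((n : ℝ) - k - 2) < signlessSpectralRadius (extremalGraph n k) := by
  classical
  set H := extremalGraph n k
  obtain ⟨b, rfl⟩ : ∃ b, n = k + 3 + b := ⟨n - k - 3, by omega⟩
  have hb : k + 3 + b - k - 3 = b := by omega
  set x : Fin 2 ⊕ (Fin (k + 1) ⊕ Fin (k + 3 + b - k - 3)) → ℝ :=
    Sum.elim (fun _ => 1) (Sum.elim (fun _ => 0) (fun _ => 1)) with hx
  have hxx : dotProduct x x = b + 2 := by
    simp only [dotProduct, Fintype.sum_sum_type, hx]
    simp [hb]
    ring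
  have h1 : ∀ a : Fin 2, Matrix.mulVec (signlessLaplacian H) x (Sum.inl a) =
      2 * (b + 1) + (k + 1) := by
    intro a
    rw [signlessLaplacian_mulVec_apply]
    simp only [Fintype.sum_sum_type, hx, H]
    fin_cases a <;> simp [hb] <;> ring
  have h2 : ∀ a : Fin (k + 3 + b - k - 3),
      Matrix.mulVec (signlessLaplacian H) x (Sum.inr (Sum.inr a)) ≥ 2 * (b + 1) := by
    intro a
    have hpos : 1 ≤ k + 3 + b - k - 3 := by have := a.2; omega
    have hcl : (∑ j, if H.Adj (Sum.inr (Sum.inr a)) (Sum.inr (Sum.inr j)) then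
        x (Sum.inr (Sum.inr a)) + x (Sum.inr (Sum.inr j)) else 0) = 2 * ((b : ℝ) - 1) := by
      simp only [hx, H, extremalGraph_adj_clique, Sum.elim_inr]
      rw [← Finset.sum_filter, Finset.filter_ne, Finset.sum_const, Finset.card_erase_of_mem
        (Finset.mem_univ a), Finset.card_univ, Fintype.card_fin, nsmul_eq_mul,
        Nat.cast_sub hpos, hb]
      push_cast; ring
    rw [signlessLaplacian_mulVec_apply, Fintype.sum_sum_type, Fintype.sum_sum_type, hcl]
    have h3 : (∑ j, if H.Adj (Sum.inr (Sum.inr a)) (Sum.inl j) then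
        x (Sum.inr (Sum.inr a)) + x (Sum.inl j) else 0) = 4 := by
      simp [hx, H]; norm_num
    have h4 : 0 ≤ ∑ j, if H.Adj (Sum.inr (Sum.inr a)) (Sum.inr (Sum.inl j)) then
        x (Sum.inr (Sum.inr a)) + x (Sum.inr (Sum.inl j)) else 0 := by
      refine Finset.sum_nonneg fun j _ => ?_
      split_ifs <;> simp [hx]
    linarith
  have hq : 2 * ((b : ℝ) + 1) * (b + 2) <
      dotProduct x (Matrix.mulVec (signlessLaplacian H) x) := by
    have h5 : (b : ℝ) * (2 * (b + 1)) ≤ ∑ a : Fin (k + 3 + b - k - 3),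
        Matrix.mulVec (signlessLaplacian H) x (Sum.inr (Sum.inr a)) := by
      have := Finset.card_nsmul_le_sum Finset.univ _ _
        fun (a : Fin (k + 3 + b - k - 3)) _ => (h2 a)
      rw [Finset.card_univ, Fintype.card_fin, nsmul_eq_mul] at this
      rwa [show ((k + 3 + b - k - 3 : ℕ) : ℝ) = b by rw [hb]] at this
    have h6 : dotProduct x (Matrix.mulVec (signlessLaplacian H) x) =
        2 * (2 * (b + 1) + (k + 1)) + ∑ a : Fin (k + 3 + b - k - 3),
        Matrix.mulVec (signlessLaplacian H) x (Sum.inr (Sum.inr a)) := by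
      rw [dotProduct, Fintype.sum_sum_type, Fintype.sum_sum_type]
      simp only [h1]
      simp [hx]
      ring
    have : (0 : ℝ) ≤ k := Nat.cast_nonneg k
    rw [h6]
    nlinarith
  have hR := dotProduct_signlessLaplacian_le H x
  rw [hxx] at hR
  push_cast
  have hb0 : (0 : ℝ) < b + 2 := by positivity
  have := lt_of_mul_lt_mul_right (hq.trans_le hR) hb0.le
  linarith

/-! ### Matchings through a given edge -/

@[simp] theorem graphJoin_adj_inl_inl {V W : Type*} {G : SimpleGraph V} {H : SimpleGraph W}
    {a b : V} : (graphJoin G H).Adj (Sum.inl a) (Sum.inl b) ↔ G.Adj a b := by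
  simp [graphJoin]

@[simp] theorem graphJoin_adj_inr_inr {V W : Type*} {G : SimpleGraph V} {H : SimpleGraph W}
    {a b : W} : (graphJoin G H).Adj (Sum.inr a) (Sum.inr b) ↔ H.Adj a b := by
  simp [graphJoin]

@[simp] theorem graphJoin_adj_inl_inr {V W : Type*} {G : SimpleGraph V} {H : SimpleGraph W}
    {a : V} {b : W} : (graphJoin G H).Adj (Sum.inl a) (Sum.inr b) := by
  simp [graphJoin]

theorem graphJoin_top_adj_inr {V W : Type*} {G : SimpleGraph V} {b : W} {x : V ⊕ W}
    (hx : x ≠ Sum.inr b) : (graphJoin G (⊤ : SimpleGraph W)).Adj (Sum.inr b) x := by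
  rcases x with a | c
  · exact graphJoin_adj_inl_inr.symm
  · simpa [eq_comm] using hx

/-- A spanning subgraph `R` of `G` of maximum degree at most one with at least `2 m` non-isolated
vertices contains a matching with exactly `m` edges, through any prescribed edge of `R`. -/
theorem exists_isMatching_ncard_eq {V : Type*} [Fintype V] {G R : SimpleGraph V} (hRG : R ≤ G)
    (huniq : ∀ a b c, R.Adj a b → R.Adj a c → b = c) {e : Sym2 V} (he : e ∈ R.edgeSet) {m : ℕ}
    (hm : 1 ≤ m) (hcard : 2 * m ≤ {a | ∃ b, R.Adj a b}.ncard) :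
    ∃ M : G.Subgraph, M.IsMatching ∧ M.edgeSet.ncard = m ∧ e ∈ M.edgeSet := by
  classical
  have hmE : m ≤ R.edgeFinset.card := by
    have h1 := R.sum_degrees_eq_twice_card_edges
    have h2 : {a | ∃ b, R.Adj a b}.ncard ≤ ∑ a, R.degree a := by
      rw [Set.ncard_eq_toFinset_card', Finset.card_eq_sum_ones]
      refine (Finset.sum_le_sum fun a ha => ?_).trans
        (Finset.sum_le_sum_of_subset (f := fun a => R.degree a) (Finset.subset_univ _))
      obtain ⟨b, hb⟩ := Set.mem_toFinset.1 ha
      exact (R.degree_pos_iff_exists_adj a).2 ⟨b, hb⟩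
    omega
  obtain ⟨E, heE, hER, hEm⟩ := Finset.exists_subsuperset_card_eq
    (Finset.singleton_subset_iff.2 (SimpleGraph.mem_edgeFinset.2 he))
    (by rwa [Finset.card_singleton]) hmE
  have hER' : ∀ a b, s(a, b) ∈ E → R.Adj a b := fun a b h => by
    simpa using SimpleGraph.mem_edgeFinset.1 (hER h)
  let M : G.Subgraph :=
    { verts := {a | ∃ b, s(a, b) ∈ E}
      Adj := fun a b => s(a, b) ∈ E
      adj_sub := fun h => hRG (hER' _ _ h)
      edge_vert := fun h => ⟨_, h⟩
      symm := ⟨fun a b h => by rwa [Sym2.eq_swap]⟩ }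
  have hME : M.edgeSet = E := by
    ext x
    induction x with
    | _ a b => exact Iff.rfl
  refine ⟨M, ?_, ?_, ?_⟩
  · rintro a ⟨b, hb⟩
    exact ⟨b, hb, fun c hc => huniq a c b (hER' _ _ hc) (hER' _ _ hb)⟩
  · rw [hME, Set.ncard_coe_finset, hEm]
  · rw [hME]
    exact heE (Finset.mem_singleton_self e)

/-- If `G - u - v` becomes perfectly matchable after joining it with `K_k`, then `uv` lies in a
matching of `G` that misses at most `k` vertices. -/
theorem exists_isMatching_of_isPerfectMatching_graphJoin {V : Type*} [Fintype V]
    {G : SimpleGraph V} {u v : V} (huv : G.Adj u v) {k m : ℕ} (hm : 1 ≤ m)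
    (hmk : 2 * m + k ≤ Fintype.card V)
    {M : (graphJoin (G.comap (Subtype.val : {w // w ≠ u ∧ w ≠ v} → V))
      (⊤ : SimpleGraph (Fin k))).Subgraph} (hM : M.IsPerfectMatching) :
    ∃ M : G.Subgraph, M.IsMatching ∧ M.edgeSet.ncard = m ∧ s(u, v) ∈ M.edgeSet := by
  classical
  have hMu : ∀ x y z, M.Adj x y → M.Adj x z → y = z := fun x y z hy hz =>
    hM.1.eq_of_adj_left hy hz
  -- `R` consists of the edge `uv` and of the edges of `M` that do not meet `K_k`.
  let R : SimpleGraph V :=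
    { Adj := fun a b => (a = u ∧ b = v) ∨ (a = v ∧ b = u) ∨
        ∃ (ha : a ≠ u ∧ a ≠ v) (hb : b ≠ u ∧ b ≠ v), M.Adj (Sum.inl ⟨a, ha⟩) (Sum.inl ⟨b, hb⟩)
      symm := ⟨fun a b h => by
        rcases h with h | h | ⟨ha, hb, h⟩
        · exact Or.inr (Or.inl h.symm)
        · exact Or.inl h.symm
        · exact Or.inr (Or.inr ⟨hb, ha, h.symm⟩)⟩
      loopless := ⟨fun a h => by
        rcases h with ⟨rfl, h⟩ | ⟨rfl, h⟩ | ⟨ha, hb, h⟩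
        · exact huv.ne h
        · exact huv.ne h.symm
        · exact h.ne rfl⟩ }
  refine exists_isMatching_ncard_eq (R := R) ?_ ?_ (Or.inl ⟨rfl, rfl⟩) hm ?_
  · rintro a b (⟨rfl, rfl⟩ | ⟨rfl, rfl⟩ | ⟨ha, hb, h⟩)
    · exact huv
    · exact huv.symm
    · simpa using h.adj_sub
  · rintro a b c (⟨rfl, rfl⟩ | ⟨rfl, rfl⟩ | ⟨ha, hb, h⟩)
      (⟨h1, rfl⟩ | ⟨h1, rfl⟩ | ⟨ha', hc, h'⟩)
    · rfl
    · exact h1.symm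
    · exact absurd rfl ha'.1
    · exact h1.symm
    · rfl
    · exact absurd rfl ha'.2
    · exact absurd h1 ha.1
    · exact absurd h1 ha.2
    · simpa using hMu _ _ _ h h'
  · -- A vertex isolated in `R` is matched by `M` with a vertex of `K_k`.
    have hex : ∀ a ∈ {a | ∃ b, R.Adj a b}ᶜ, ∃ i : Fin k, ∃ ha : a ≠ u ∧ a ≠ v,
        M.Adj (Sum.inl ⟨a, ha⟩) (Sum.inr i) := by
      intro a ha
      have hau : a ≠ u := by rintro rfl; exact ha ⟨v, Or.inl ⟨rfl, rfl⟩⟩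
      have hav : a ≠ v := by rintro rfl; exact ha ⟨u, Or.inr (Or.inl ⟨rfl, rfl⟩)⟩
      obtain ⟨y, hy, -⟩ := hM.1 (hM.2 (Sum.inl ⟨a, hau, hav⟩))
      rcases y with ⟨b, hb⟩ | i
      · exact absurd ⟨b, Or.inr (Or.inr ⟨⟨hau, hav⟩, hb, hy⟩)⟩ ha
      · exact ⟨i, ⟨hau, hav⟩, hy⟩
    choose g hg using fun a : ({a | ∃ b, R.Adj a b}ᶜ : Set V) => hex a a.2
    have hg_inj : Function.Injective g := by
      intro a b hab
      obtain ⟨ha', h1⟩ := hg a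
      obtain ⟨hb', h2⟩ := hg b
      rw [← hab] at h2
      exact Subtype.ext (by simpa using hMu _ _ _ h1.symm h2.symm)
    have hle : ({a | ∃ b, R.Adj a b}ᶜ : Set V).ncard ≤ k := by
      have h := Nat.card_le_card_of_injective g hg_inj
      rwa [Nat.card_coe_set_eq, Nat.card_fin] at h
    have := Set.ncard_add_ncard_compl {a | ∃ b, R.Adj a b}
    rw [Nat.card_eq_fintype_card] at this
    omega

/-- A Tutte–Berge type obstruction: if the edge `uv` lies in no matching of size `m = (n - k) / 2`,
then some vertex set `S` containing `u` and `v` leaves at least `|S| + k` components. They are given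
by a labelling `f`, constant along the edges outside `S`, with at least `|S| + k` values there.
A Tutte violator of the join of `G - u - v` with `K_k` provides the set: it contains `K_k`, as
otherwise the rest would be connected, and parity raises the surplus of components from one to
two. -/
theorem exists_cut_of_forall_not_isMatching {V : Type*} [Fintype V] [DecidableEq V]
    {G : SimpleGraph V} {u v : V} (huv : G.Adj u v) {k m : ℕ} (hm : 1 ≤ m)
    (hmk : 2 * m + k = Fintype.card V)
    (hno : ∀ M : G.Subgraph, M.IsMatching → M.edgeSet.ncard = m → s(u, v) ∉ M.edgeSet) :
    ∃ (S : Finset V) (f : V → ℕ), u ∈ S ∧ v ∈ S ∧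
      (∀ a ∉ S, ∀ b ∉ S, G.Adj a b → f a = f b) ∧ S.card + k ≤ (Sᶜ.image f).card := by
  classical
  set J := graphJoin (G.comap (Subtype.val : {w // w ≠ u ∧ w ≠ v} → V))
    (⊤ : SimpleGraph (Fin k)) with hJ
  have hJcard : Nat.card ({w // w ≠ u ∧ w ≠ v} ⊕ Fin k) + 2 = Fintype.card V + k := by
    have h1 : Fintype.card {w // w ≠ u ∧ w ≠ v} + 2 = Fintype.card V := by
      rw [Fintype.card_subtype]
      have h2 : (Finset.univ.filter fun w => w ≠ u ∧ w ≠ v) = ({u, v} : Finset V)ᶜ := by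
        ext w; simp
      rw [h2, ← Finset.card_pair huv.ne, Finset.card_compl_add_card]
    rw [Nat.card_eq_fintype_card, Fintype.card_sum, Fintype.card_fin]
    omega
  have hT : ∃ T, J.IsTutteViolator T := by
    by_contra! h
    obtain ⟨M, hM⟩ := SimpleGraph.tutte.2 h
    obtain ⟨M', h1, h2, h3⟩ := exists_isMatching_of_isPerfectMatching_graphJoin huv hm hmk.le hM
    exact hno M' h1 h2 h3
  obtain ⟨T, hT⟩ := hT
  rw [SimpleGraph.IsTutteViolator] at hT
  set D := ((⊤ : J.Subgraph).deleteVerts T).coe with hD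
  have hDadj : ∀ (x y) (hx : x ∉ T) (hy : y ∉ T), J.Adj x y →
      D.Adj ⟨x, by simpa using hx⟩ ⟨y, by simpa using hy⟩ := by
    intro x y hx hy h
    simp [hD, hx, hy, h]
  have hodd : T.ncard + 2 ≤ D.oddComponents.ncard := by
    have h1 := D.odd_ncard_oddComponents
    have h2 : Nat.card ((⊤ : J.Subgraph).deleteVerts T).verts + T.ncard =
        Nat.card ({w // w ≠ u ∧ w ≠ v} ⊕ Fin k) := by
      rw [Nat.card_coe_set_eq, SimpleGraph.Subgraph.deleteVerts_verts,
        SimpleGraph.Subgraph.verts_top, ← Set.compl_eq_univ_sdiff, add_comm,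
        Set.ncard_add_ncard_compl]
    rw [Nat.odd_iff, Nat.odd_iff] at h1
    omega
  have hcomp : D.oddComponents.ncard ≤ Nat.card D.ConnectedComponent := by
    rw [← Set.ncard_univ]
    exact Set.ncard_le_ncard (Set.subset_univ _)
  have hKT : ∀ i : Fin k, Sum.inr i ∈ T := by
    intro i
    by_contra hi
    have hsub : Subsingleton D.ConnectedComponent := by
      have key : ∀ y, D.connectedComponentMk y =
          D.connectedComponentMk ⟨Sum.inr i, by simpa using hi⟩ := by
        rintro ⟨y, hy⟩
        by_cases hyi : y = Sum.inr i
        · subst hyi; rfl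
        · exact (SimpleGraph.ConnectedComponent.sound
            (hDadj _ _ hi (by simpa using hy) (graphJoin_top_adj_inr hyi)).reachable).symm
      refine ⟨fun a b => ?_⟩
      induction a using SimpleGraph.ConnectedComponent.ind with | _ a =>
      induction b using SimpleGraph.ConnectedComponent.ind with | _ b =>
      rw [key a, key b]
    have := Finite.card_le_one_iff_subsingleton.2 hsub
    omega
  obtain ⟨r, φ⟩ : ∃ r, Nonempty (D.ConnectedComponent ≃ Fin r) :=
    ⟨_, ⟨Finite.equivFin D.ConnectedComponent⟩⟩
  obtain ⟨φ⟩ := φ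
  set S : Finset V := Finset.univ.filter fun w => ∀ h : w ≠ u ∧ w ≠ v, Sum.inl ⟨w, h⟩ ∈ T with hS
  have hSn : ∀ a, a ∉ S → ∃ h : a ≠ u ∧ a ≠ v, (Sum.inl ⟨a, h⟩ : _ ⊕ Fin k) ∉ T := by
    intro a ha
    rw [hS, Finset.mem_filter] at ha
    push Not at ha
    exact ha (Finset.mem_univ a)
  let f : V → ℕ := fun a =>
    if h : ∃ h : a ≠ u ∧ a ≠ v, (Sum.inl ⟨a, h⟩ : _ ⊕ Fin k) ∉ T then
      φ (D.connectedComponentMk ⟨Sum.inl ⟨a, h.1⟩, by simpa using h.2⟩) else 0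
  refine ⟨S, f, by simp [hS], by simp [hS], ?_, ?_⟩
  · intro a ha b hb hab
    have ha' := hSn a ha
    have hb' := hSn b hb
    simp only [f, dif_pos ha', dif_pos hb']
    congr 2
    exact SimpleGraph.ConnectedComponent.sound (hDadj _ _ ha'.2 hb'.2 (by simpa [hJ])).reachable
  · have hr : Nat.card D.ConnectedComponent = r := by
      rw [Nat.card_congr φ, Nat.card_eq_fintype_card, Fintype.card_fin]
    have himg : Finset.range r ⊆ Sᶜ.image f := by
      intro l hl
      obtain ⟨c, hc⟩ := φ.surjective ⟨l, Finset.mem_range.1 hl⟩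
      induction c using SimpleGraph.ConnectedComponent.ind with | _ x =>
      obtain ⟨x, hx⟩ := x
      have hxT : x ∉ T := by simpa using hx
      rcases x with ⟨a, ha⟩ | i
      · refine Finset.mem_image.2 ⟨a, ?_, ?_⟩
        · rw [Finset.mem_compl, hS, Finset.mem_filter]
          exact fun h => hxT (h.2 ha)
        · have h' : ∃ h : a ≠ u ∧ a ≠ v, (Sum.inl ⟨a, h⟩ : _ ⊕ Fin k) ∉ T := ⟨ha, hxT⟩
          simp only [f, dif_pos h', hc]
      · exact absurd (hKT i) hxT
    have h1 := Finset.card_le_card himg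
    rw [Finset.card_range] at h1
    have h2 : S.card + k ≤ T.ncard + 2 := by
      -- `S \ {u, v}` together with `K_k` embeds in `T`.
      have h3 : ((S \ {u, v}).card + k) ≤ T.ncard := by
        let g : {w // w ∈ S \ {u, v}} ⊕ Fin k → {w // w ≠ u ∧ w ≠ v} ⊕ Fin k :=
          Sum.map (fun w => ⟨w.1, by simpa using (Finset.mem_sdiff.1 w.2).2⟩) id
        have hg : Function.Injective g := Function.Injective.sumMap
          (fun a b h => Subtype.ext (by simpa using h)) Function.injective_id
        have h4 := Set.ncard_le_ncard (s := Set.range g) (t := T) (by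
          rintro _ ⟨w | i, rfl⟩
          · exact (Finset.mem_filter.1 (Finset.mem_sdiff.1 w.2).1).2 _
          · exact hKT i) (Set.toFinite T)
        rwa [← Set.image_univ, Set.ncard_image_of_injective _ hg, Set.ncard_univ,
          Nat.card_eq_fintype_card, Fintype.card_sum, Fintype.card_fin, Fintype.card_coe] at h4
      have h5 := Finset.le_card_sdiff ({u, v} : Finset V) S
      have h6 := Finset.card_pair huv.ne
      omega
    omega

/-! ### Comparison with the extremal graph -/

theorem Finset.card_fiber_add_card_image_le {V ι : Type*} [DecidableEq ι] (T : Finset V)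
    (f : V → ι) (a : V) :
    (T.filter (fun b => f b = f a)).card + (T.image f).card ≤ T.card + 1 := by
  classical
  have h1 : T.image f ⊆ insert (f a) ((T.filter (fun b => ¬ f b = f a)).image f) := by
    intro l hl
    obtain ⟨b, hb, rfl⟩ := Finset.mem_image.1 hl
    by_cases h : f b = f a
    · simp [h]
    · exact Finset.mem_insert_of_mem (Finset.mem_image_of_mem f (by simp [hb, h]))
  have h2 := (Finset.card_le_card h1).trans (Finset.card_insert_le _ _)
  have h3 : ((T.filter (fun b => ¬ f b = f a)).image f).card ≤ _ := Finset.card_image_le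
  have h4 := Finset.card_filter_add_card_filter_not (s := T) (fun b => f b = f a)
  omega

/-- If removing two vertices leaves `k + 2` classes without edges between them, one of them of
size `n - k - 3`, then the other classes are singletons, so that `G` is a spanning subgraph of the
extremal graph; hence `G` is that graph or has smaller `q`. -/
theorem lt_or_iso_extremalGraph {V ι : Type*} [Fintype V] [DecidableEq V] [DecidableEq ι]
    (G : SimpleGraph V) {k : ℕ} (hk : k + 3 ≤ Fintype.card V) {S : Finset V} (hS : S.card = 2)
    {f : V → ι} (hf : ∀ a ∉ S, ∀ b ∉ S, G.Adj a b → f a = f b)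
    (hp : k + 2 ≤ (Sᶜ.image f).card) {a₀ : V}
    (ha₀ : (Sᶜ.filter (fun b => f b = f a₀)).card = Fintype.card V - k - 3) :
    signlessSpectralRadius G < signlessSpectralRadius (extremalGraph (Fintype.card V) k) ∨
      Nonempty (G ≃g extremalGraph (Fintype.card V) k) := by
  set C := Sᶜ.filter (fun b => f b = f a₀) with hC
  set I := Sᶜ.filter (fun b => ¬ f b = f a₀) with hI
  have hCS : ∀ a ∈ C, a ∉ S ∧ f a = f a₀ := fun a ha => by simpa [hC] using ha
  have hIS : ∀ a ∈ I, a ∉ S ∧ f a ≠ f a₀ := fun a ha => by simpa [hI] using ha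
  have hIcard : I.card = k + 1 := by
    have h1 : C.card + I.card = Sᶜ.card :=
      Finset.card_filter_add_card_filter_not (s := Sᶜ) (fun b => f b = f a₀)
    have h2 := Finset.card_compl S
    omega
  have hinj : Set.InjOn f I := by
    refine Finset.card_image_iff.1 (le_antisymm Finset.card_image_le ?_)
    have h1 : Sᶜ.image f ⊆ insert (f a₀) (I.image f) := by
      intro l hl
      obtain ⟨b, hb, rfl⟩ := Finset.mem_image.1 hl
      by_cases h : f b = f a₀
      · simp [h]
      · exact Finset.mem_insert_of_mem
          (Finset.mem_image_of_mem f (Finset.mem_filter.2 ⟨hb, h⟩))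
    have h2 := (Finset.card_le_card h1).trans (Finset.card_insert_le _ _)
    omega
  let g : Fin 2 ⊕ (Fin (k + 1) ⊕ Fin (Fintype.card V - k - 3)) → V :=
    Sum.elim (fun i => (S.equivFinOfCardEq hS).symm i)
      (Sum.elim (fun i => (I.equivFinOfCardEq hIcard).symm i)
        (fun i => (C.equivFinOfCardEq ha₀).symm i))
  have g1 : ∀ i, g (Sum.inl i) ∈ S := fun i => Subtype.coe_prop _
  have g2 : ∀ i, g (Sum.inr (Sum.inl i)) ∈ I := fun i => Subtype.coe_prop _
  have g3 : ∀ i, g (Sum.inr (Sum.inr i)) ∈ C := fun i => Subtype.coe_prop _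
  have hg_inj : Function.Injective g := by
    refine Function.Injective.sumElim
      (Subtype.val_injective.comp (Equiv.injective _))
      (Function.Injective.sumElim
        (Subtype.val_injective.comp (Equiv.injective _))
        (Subtype.val_injective.comp (Equiv.injective _)) fun i j h => ?_) fun i j h => ?_
    · exact (hIS _ (g2 i)).2 ((congrArg f h).trans (hCS _ (g3 j)).2)
    · have hi := g1 i
      rcases j with j | j
      · exact (hIS _ (g2 j)).1 (by rwa [show g (Sum.inl i) = g (Sum.inr (Sum.inl j)) from h] at hi)
      · exact (hCS _ (g3 j)).1 (by rwa [show g (Sum.inl i) = g (Sum.inr (Sum.inr j)) from h] at hi)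
  have hg : Function.Bijective g := by
    refine (Fintype.bijective_iff_injective_and_card g).2 ⟨hg_inj, ?_⟩
    simp only [Fintype.card_sum, Fintype.card_fin]
    omega
  let e := Equiv.ofBijective g hg
  have hiso : G.comap e ≃g G := SimpleGraph.Iso.comap e G
  have : Nonempty (Fin 2 ⊕ (Fin (k + 1) ⊕ Fin (Fintype.card V - k - 3))) := ⟨Sum.inl 0⟩
  have hle : G.comap e ≤ extremalGraph (Fintype.card V) k := by
    rintro (i | i | i) (j | j | j) hij
    · simpa using fun h : i = j => hij.ne (by rw [h])
    · simp
    · simp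
    · simp
    · refine absurd ?_ hij.ne
      have h := hf _ (hIS _ (g2 i)).1 _ (hIS _ (g2 j)).1 hij
      exact hg_inj (hinj (g2 i) (g2 j) h)
    · have h := hf _ (hIS _ (g2 i)).1 _ (hCS _ (g3 j)).1 hij
      exact absurd (h.trans (hCS _ (g3 j)).2) (hIS _ (g2 i)).2
    · simp
    · have h := hf _ (hCS _ (g3 i)).1 _ (hIS _ (g2 j)).1 hij
      exact absurd (h.symm.trans (hCS _ (g3 i)).2) (hIS _ (g2 j)).2
    · simpa using fun h : i = j => hij.ne (by rw [h])
  rcases hle.eq_or_lt with h | h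
  · exact Or.inr ⟨h ▸ hiso.symm⟩
  · left
    rw [← hiso.signlessSpectralRadius_eq]
    refine signlessSpectralRadius_lt_of_lt h (c := Sum.inl 0) ?_
    rintro (j | j) hj
    · simpa [eq_comm] using hj
    · simp

/-- A cut `S` of at least two vertices that leaves at least `|S| + k` components forces `q(G)` below
that of the extremal graph, unless `G` is the extremal graph. -/
theorem signlessSpectralRadius_lt_or_iso_of_cut {V : Type*} [Fintype V] [DecidableEq V]
    (G : SimpleGraph V) {k : ℕ} (hk : 5 * k + 8 ≤ Fintype.card V) {S : Finset V}
    (hS : 2 ≤ S.card) {f : V → ℕ} (hf : ∀ a ∉ S, ∀ b ∉ S, G.Adj a b → f a = f b)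
    (hp : S.card + k ≤ (Sᶜ.image f).card) :
    signlessSpectralRadius G < signlessSpectralRadius (extremalGraph (Fintype.card V) k) ∨
      Nonempty (G ≃g extremalGraph (Fintype.card V) k) := by
  have hSne : S.Nonempty := Finset.card_pos.1 (by omega)
  have hlow := lt_signlessSpectralRadius_extremalGraph (n := Fintype.card V) (k := k) (by omega)
  have hcompl := Finset.card_compl S
  have hSV := Finset.card_le_univ S
  have himg : (Sᶜ.image f).card ≤ Sᶜ.card := Finset.card_image_le
  have hfib : ∀ a, (Sᶜ.filter (fun b => f b = f a)).card + 2 * S.card + k ≤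
      Fintype.card V + 1 := by
    intro a
    have := Finset.card_fiber_add_card_image_le Sᶜ f a
    omega
  set n := Fintype.card V with hn
  have hk' : 4 * (k : ℝ) + 8 ≤ (n : ℝ) - k := by
    have : ((5 * k + 8 : ℕ) : ℝ) ≤ n := Nat.cast_le.2 hk
    push_cast at this
    linarith
  rcases hS.eq_or_lt with h2 | h3
  · by_cases hbig : ∃ a, (Sᶜ.filter (fun b => f b = f a)).card = n - k - 3
    · obtain ⟨a, ha⟩ := hbig
      exact lt_or_iso_extremalGraph G (by omega) h2.symm hf (by omega) ha
    · left
      push Not at hbig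
      refine lt_of_le_of_lt (signlessSpectralRadius_le_of_classes G hSne hf hp
        (B := n - k - 4) (by omega) (fun a _ => ?_) rfl ?_ ?_) hlow
      · have h1 := hbig a
        have h4 := hfib a
        omega
      all_goals
        rw [← h2, Nat.cast_sub (by omega), Nat.cast_sub (by omega)]
        push_cast
      · linarith
      · have h := cut_two_inequality (Nat.cast_nonneg (α := ℝ) k) hk'
        convert h using 1
        ring
  · left
    have hs3 : (3 : ℝ) ≤ S.card := by exact_mod_cast h3
    have hs2 : 2 * (S.card : ℝ) ≤ (n : ℝ) - k := by
      have : ((2 * S.card + k : ℕ) : ℝ) ≤ n := Nat.cast_le.2 (by omega)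
      push_cast at this
      linarith
    have hB : ((n + 1 - 2 * S.card - k : ℕ) : ℝ) = n + 1 - 2 * S.card - k := by
      rw [Nat.cast_sub (by omega), Nat.cast_sub (by omega)]
      push_cast
      rfl
    refine lt_of_le_of_lt (signlessSpectralRadius_le_of_classes G hSne hf hp
        (B := n + 1 - 2 * S.card - k) (by omega) (fun a _ => ?_) rfl ?_ ?_) hlow
    · have h4 := hfib a
      omega
    · rw [hB]
      linarith
    · rw [hB]
      have h := large_cut_inequality hs3 hs2 hk'
      push_cast
      convert h using 1
      ring

theorem theorem2 {V : Type*} [Fintype V] (G : SimpleGraph V) (n k : ℕ)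
    (hn : Fintype.card V = n) (hnk : 5 * k + 7 ≤ n) (hpar : n ≡ k [MOD 2])
    (hq : signlessSpectralRadius (extremalGraph n k) ≤ signlessSpectralRadius G) :
    EveryEdgeInMatchingOfSize G ((n - k) / 2) ∨ Nonempty (G ≃g extremalGraph n k) := by
  classical
  subst hn
  rw [Nat.ModEq] at hpar
  by_contra! hcon
  obtain ⟨hmat, hiso⟩ := hcon
  rw [EveryEdgeInMatchingOfSize] at hmat
  push Not at hmat
  obtain ⟨e, he, hno⟩ := hmat
  induction e with | _ u v =>
  have huv : G.Adj u v := he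
  obtain ⟨S, f, huS, hvS, hf, hp⟩ :=
    exists_cut_of_forall_not_isMatching huv (k := k) (m := (Fintype.card V - k) / 2)
      (by omega) (by omega) hno
  have hS : 2 ≤ S.card := by
    rw [← Finset.card_pair huv.ne]
    exact Finset.card_le_card (by simp [Finset.insert_subset_iff, huS, hvS])
  -- Parity turns `5 k + 7 ≤ n` into `5 k + 8 ≤ n`.
  rcases signlessSpectralRadius_lt_or_iso_of_cut G (k := k) (by omega) hS hf hp with h | h
  · exact absurd hq (not_le.2 h)
  · exact h.elim hiso.false
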